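/- **Setting.** Let $(\Omega,\mathcal F,\mathbb P)$ be a probability space and $\mathcal K=\{1,\dots,K\}$ a set of sources. A marked point process with mark space $\mathcal K\times[0,\infty)$ is a locally finite random counting measure on $\mathbb R\times\mathcal K\times[0,\infty)$; its realizations may be empty, and on the event that it is not empty its points are numbered by $n\in\mathbb Z$ in increasing order of time, number $0$ being the last point in $(-\infty,0]$ and number $1$ the first point in $(0,\infty)$. It is simple if a.s. no two points have the same time, and stationary if its law is invariant under translations of the time axis. For a stationary marked point process with numbered points $(T_n,c_n,S_n)_{n\in\mathbb Z}$, let $\Phi$ count the times $T_n$, let $\Phi_k$ count those $T_n$ with $c_n=k$, and let $\lambda=\mathbb E[\Phi(0,1]]$ and $\lambda_k=\mathbb E[\Phi_k(0,1]]$ be their intensities. The Palm probability of $\Phi$ is $$\mathbb P^0_\Phi\bigl((T_j,c_j,S_j)_{j\in\mathbb Z}\in A\bigr)=\frac1\lambda\,\mathbb E\Bigl[\sum_{n\in\mathbb Z}\mathbf 1\{T_n\in(0,1]\}\,\mathbf 1\bigl\{(T_{n+j}-T_n,c_{n+j},S_{n+j})_{j\in\mathbb Z}\in A\bigr\}\Bigr]$$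 (the sum being $0$ on the event that the process is empty), and $\mathbb P^0_{\Phi_k}$ is defined in the same way with $\lambda_k$ in place of $\lambda$ and $\mathbf 1\{T_n\in(0,1],\,c_n=k\}$ in place of $\mathbf 1\{T_n\in(0,1]\}$. **Input.** Packet $n$ is generated at time $T_n$ by source $c_n$ with required service time $S_n$; put $\tau_n=T_{n+1}-T_n$. Assume that 1. $\Phi$ is a.s. simple and points are numbered so that $\cdots<T_{-1}<T_0\le 0<T_1<\cdots$; 2. the marked point process $\Phi_{c,S}$ of the $(T_n,c_n,S_n)$ is stationary with mark space $\mathcal K\times[0,\infty)$; 3. $0<\lambda<\infty$; 4. $\mathbb P^0_\Phi(c_0=k)>0$ for all $k\in\mathcal K$; 5. $\mathbb P^0_{\Phi_k}(S_0\le\tau_0)>0$ for all $k\in\mathcal K$; 6. a.s. there is no $n$ with $S_n=\tau_n$ and $S_{n+1}=0$ (no two packets are completed at the same instant). **Output.** In the pushout server each packet starts service at its generation and is lost if the next packet is generated before its service is completed. The output is the marked point process $$\Psi_{C,D}(B\times\{k\}\times E)=\sum_{n\in\mathbb Z}\mathbf 1_B(T_n+S_n)\,\mathbf 1_{E\cap[0,\tau_n]}(S_n)\,\mathbf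 1_{\{k\}}(c_n),\qquad B\in\mathcal B(\mathbb R),\ k\in\mathcal K,\ E\in\mathcal B([0,\infty)),$$ with points $(U_n,C_n,D_n)$ (completion time, source, delay). Let $\Psi$ count all the completion times and let $\Psi_k$ count those of source $k$ packets. **Lemma.** Under these assumptions: 1. $\Psi$ is a.s. simple and, a.s. on the event that it is not empty, its points form a two-sided infinite sequence $\cdots<U_{-1}<U_0\le0<U_1<\cdots$; 2. $\Psi_{C,D}$ is stationary with mark space $\mathcal K\times[0,\infty)$; 3. $\lambda_\Psi=\mathbb E[\Psi(0,1]]$ is positive and finite; 4. $\mathbb P^0_\Psi(C_0=k)>0$ for all $k\in\mathcal K$; 5. $\mathbb P^0_{\Psi_k}(D_0<\infty)=1$ for all $k\in\mathcal K$. Moreover, $$\lambda_\Psi=\lambda\,\mathbb P^0_\Phi(S_0\le\tau_0)=\sum_{k=1}^K\lambda_k\,\mathbb P^0_{\Phi_k}(S_0\le\tau_0),$$ and, for every $k\in\mathcal K$, $$\mathbb P^0_\Psi(C_0=k)=\mathbb P^0_\Phi(c_0=k\mid S_0\le\tau_0)=\frac{\lambda_k\,\mathbb P^0_{\Phi_k}(S_0\le\tau_0)}{\sum_{j=1}^K\lambda_j\,\mathbb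 P^0_{\Phi_j}(S_0\le\tau_0)}.$$ -/

import Mathlib

open MeasureTheory Set
open scoped NNReal ENNReal

namespace PushoutServer

noncomputable section

/-- Translation of the time axis: a point at time `u` is moved to time `u - t`,
marks are unchanged. -/
def shift {M : Type*} [MeasurableSpace M] (t : ℝ) (ν : Measure (ℝ × M)) : Measure (ℝ × M) :=
  ν.map (fun z => (z.1 - t, z.2))

/-- The marked point process (random counting measure) `N` on `ℝ × M` together with the
conventional numbering `X n = (T n, mark n)`, `n ∈ ℤ`, of its points:
`⋯ < T (-1) < T 0 ≤ 0 < T 1 < ⋯`.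

A realization of `N` may be empty (a stationary point process that is not ergodic can be empty
with positive probability); it then has no points to number, and `X` carries no
information there.  On the event `N ≠ 0` the numbering is almost surely unique. -/
structure IsNumberedProcess {Ω M : Type*} [MeasurableSpace Ω] [MeasurableSpace M]
    (P : Measure Ω) (N : Ω → Measure (ℝ × M)) (X : ℤ → Ω → ℝ × M) : Prop where
  measurable : Measurable N
  measurable_point : ∀ n, Measurable (X n)
  locallyFinite : ∀ᵐ ω ∂P, ∀ a b : ℝ, N ω (Icc a b ×ˢ univ) < ∞
  eq_sum : ∀ᵐ ω ∂P, N ω ≠ 0 → N ω = Measure.sum (fun n : ℤ => Measure.dirac (X n ω))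
  strictMono : ∀ᵐ ω ∂P, N ω ≠ 0 → StrictMono (fun n : ℤ => (X n ω).1)
  origin : ∀ᵐ ω ∂P, N ω ≠ 0 → (X 0 ω).1 ≤ 0 ∧ 0 < (X 1 ω).1

/-- Simplicity: almost surely no two points sit at the same time. -/
def IsSimple {Ω M : Type*} [MeasurableSpace Ω] [MeasurableSpace M]
    (P : Measure Ω) (N : Ω → Measure (ℝ × M)) : Prop :=
  ∀ᵐ ω ∂P, ∀ t : ℝ, N ω ({t} ×ˢ univ) ≤ 1

/-- Stationarity: the law of `N` is invariant under all translations of the time axis. -/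
def IsStationary {Ω M : Type*} [MeasurableSpace Ω] [MeasurableSpace M]
    (P : Measure Ω) (N : Ω → Measure (ℝ × M)) : Prop :=
  ∀ t : ℝ, P.map (fun ω => shift t (N ω)) = P.map N

/-- The intensity `E[N((0,1] × B)]` of the sub-process of the points with mark in `B`. -/
def intensity {Ω M : Type*} [MeasurableSpace Ω] [MeasurableSpace M]
    (P : Measure Ω) (N : Ω → Measure (ℝ × M)) (B : Set M) : ℝ≥0∞ :=
  ∫⁻ ω, N ω (Ioc 0 1 ×ˢ B) ∂P

/-- The numbered marked points as seen from the `n`-th one: point `n` gets number `0`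
and is moved to time `0`. -/
def recentre {M : Type*} (n : ℤ) (x : ℤ → ℝ × M) : ℤ → ℝ × M :=
  fun j => ((x (n + j)).1 - (x n).1, (x (n + j)).2)

/-- The Palm probability of the sub-process of the points of `N` with mark in `B`,
as the law of the numbered sequence of *all* marked points of `N`, seen from a typical point of
the sub-process:
`P⁰(A) = λ_B⁻¹ E[ ∑ₙ 1{Tₙ ∈ (0,1], markₙ ∈ B} 1_A(sequence seen from point n) ]`. -/
def palm {Ω M : Type*} [MeasurableSpace Ω] [MeasurableSpace M]
    (P : Measure Ω) (N : Ω → Measure (ℝ × M)) (X : ℤ → Ω → ℝ × M) (B : Set M) :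
    Measure (ℤ → ℝ × M) :=
  (intensity P N B)⁻¹ • Measure.sum (fun n : ℤ =>
    (P.restrict {ω | N ω ≠ 0 ∧ (X n ω).1 ∈ Ioc (0 : ℝ) 1 ∧ (X n ω).2 ∈ B}).map
      (fun ω => recentre n (fun j => X j ω)))

/-- Marks of packets: the source (one of `K`) and a nonnegative real number, which is the required
service time in the input process and the delay in the output process. -/
abbrev Mark (K : ℕ) : Type := Fin K × ℝ≥0

/-- The marks of source `k` packets. -/
def ofSource {K : ℕ} (k : Fin K) : Set (Mark K) := {k} ×ˢ univ

/-- The event that packet `0` comes from source `k`. -/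
def sourceZero {K : ℕ} (k : Fin K) : Set (ℤ → ℝ × Mark K) := {x | (x 0).2.1 = k}

/-- The event `S₀ ≤ τ₀` with `τ₀ = T₁ - T₀`: packet `0` is completed without interruption. -/
def completedZero (K : ℕ) : Set (ℤ → ℝ × Mark K) :=
  {x | ((x 0).2.2 : ℝ) ≤ (x 1).1 - (x 0).1}

/-- The requirements common to the input and the output process: a simple and stationary
marked point process, with positive and finite intensity, in which every source appears. -/
structure StationaryAssumption {Ω : Type*} [MeasurableSpace Ω] {K : ℕ} (P : Measure Ω)
    (N : Ω → Measure (ℝ × Mark K)) (X : ℤ → Ω → ℝ × Mark K) : Prop where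
  numbered : IsNumberedProcess P N X
  simple : IsSimple P N
  stationary : IsStationary P N
  intensity_pos : 0 < intensity P N univ
  intensity_lt_top : intensity P N univ < ∞
  source_pos : ∀ k : Fin K, 0 < palm P N X univ (sourceZero k)

/-- The assumption on the input process of packet generations `(Tₙ, cₙ, Sₙ)`. -/
structure InputAssumption {Ω : Type*} [MeasurableSpace Ω] {K : ℕ} (P : Measure Ω)
    (Φ : Ω → Measure (ℝ × Mark K)) (X : ℤ → Ω → ℝ × Mark K) : Prop
    extends StationaryAssumption P Φ X where
  completed_pos : ∀ k : Fin K, 0 < palm P Φ X (ofSource k) (completedZero K)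

/-- The assumption on the output process of service completions `(Uₙ, Cₙ, Dₙ)`. -/
structure OutputAssumption {Ω : Type*} [MeasurableSpace Ω] {K : ℕ} (P : Measure Ω)
    (Ψ : Ω → Measure (ℝ × Mark K)) (Y : ℤ → Ω → ℝ × Mark K) : Prop
    extends StationaryAssumption P Ψ Y where
  delay_finite : ∀ k : Fin K, palm P Ψ Y (ofSource k) {y | ((y 0).2.2 : ℝ≥0∞) < ∞} = 1

/-- Packet `n` is completed without interruption: `Sₙ ≤ τₙ = Tₙ₊₁ - Tₙ`. -/
def Completed {K : ℕ} (x : ℤ → ℝ × Mark K) (n : ℤ) : Prop :=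
  ((x n).2.2 : ℝ) ≤ (x (n + 1)).1 - (x n).1

open Classical in
/-- The output process of the pushout server: each input packet `(Tₙ, cₙ, Sₙ)` with `Sₙ ≤ τₙ`
yields a service completion at time `Tₙ + Sₙ` of a source `cₙ` packet with delay `Sₙ`; the other
packets are lost. -/
def output {Ω : Type*} {K : ℕ} (Φ : Ω → Measure (ℝ × Mark K)) (X : ℤ → Ω → ℝ × Mark K)
    (ω : Ω) : Measure (ℝ × Mark K) :=
  Measure.sum (fun n : ℤ =>
    if Φ ω ≠ 0 ∧ Completed (fun j => X j ω) n then
      Measure.dirac ((X n ω).1 + ((X n ω).2.2 : ℝ), (X n ω).2)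
    else 0)

end

end PushoutServer

namespace PushoutServer

noncomputable section

/-! ### Stationary random measures: mean measure, displaced points, recurrence. -/

section

variable {Ω M : Type*} [MeasurableSpace Ω] [MeasurableSpace M]

/-! The numbering of the packets depends on the origin of time, but the set of completed packets
does not: a packet generated at `t` with service time `s` is completed exactly when no point lies in
the open interval `(t, t + s)`. Hence the output is almost surely the image of the input
configuration under two translation-covariant operations, `thin` (keep the completed packets) and
`complete` (move each one by its service time). Stationarity passes to the output by
`IsStationary.comp`; the real work there is the measurability of `thin`,
`aemeasurable_restrict_section`.

For the rates, the mean measure of a stationary process of finite intensity is Lebesgue measure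
times a measure on marks. Moving every point by a function of its own mark preserves such a product,
so the intensity is unchanged (`IsStationary.intensity_map_add`). Completions in a mark set `B` thus
occur at the rate at which packets with mark in `B` that will be completed are generated, and by the
definition of the Palm probability this is `λ_B P⁰_B(S₀ ≤ τ₀)`. All the formulas follow by taking
for `B` all marks or one source, since the Palm probability of a source is a ratio of intensities.

For the numbering, a completed packet ends no later than the next generation, so completions occur
in the order of generation, strictly because ties are excluded. The sequence is infinite on both
sides because a stationary measure almost surely has no first or last charged unit interval: the
possible positions of such an interval would be infinitely many disjoint events of equal
probability. `enumerate` then numbers the completed packets measurably around the origin. -/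

lemma measurable_translate (t : ℝ) : Measurable (fun z : ℝ × M => (z.1 - t, z.2)) := by
  fun_prop

lemma measurable_shift (t : ℝ) : Measurable (shift t : Measure (ℝ × M) → Measure (ℝ × M)) :=
  Measure.measurable_map _ (measurable_translate t)

lemma shift_apply (t : ℝ) (ν : Measure (ℝ × M)) {s : Set ℝ} {B : Set M} (hs : MeasurableSet s)
    (hB : MeasurableSet B) : shift t ν (s ×ˢ B) = ν (((fun u => u - t) ⁻¹' s) ×ˢ B) := by
  rw [shift, Measure.map_apply (measurable_translate t) (hs.prod hB)]
  rfl

/-- The mean measure `A ↦ E[N(A)]` of a random measure. -/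
def meanMeasure (P : Measure Ω) (N : Ω → Measure (ℝ × M)) : Measure (ℝ × M) :=
  (P.map N).join

lemma meanMeasure_apply {P : Measure Ω} {N : Ω → Measure (ℝ × M)} (hN : AEMeasurable N P)
    {s : Set (ℝ × M)} (hs : MeasurableSet s) : meanMeasure P N s = ∫⁻ ω, N ω s ∂P := by
  rw [meanMeasure, Measure.join_apply hs,
    lintegral_map' (Measure.measurable_coe hs).aemeasurable hN]

lemma IsStationary.map_meanMeasure {P : Measure Ω} {N : Ω → Measure (ℝ × M)}
    (hst : IsStationary P N) (hN : AEMeasurable N P) (t : ℝ) :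
    (meanMeasure P N).map (fun z => (z.1 - t, z.2)) = meanMeasure P N := by
  ext s hs
  have h2 : meanMeasure P (fun ω => shift t (N ω)) = meanMeasure P N := by
    rw [meanMeasure, meanMeasure, hst t]
  conv_rhs => rw [← h2]
  rw [meanMeasure_apply (N := fun ω => shift t (N ω))
      ((measurable_shift t).comp_aemeasurable hN) hs, Measure.map_apply (measurable_translate t) hs,
    meanMeasure_apply hN (measurable_translate t hs)]
  refine lintegral_congr fun ω => ?_
  rw [shift, Measure.map_apply (measurable_translate t) hs]

/-- A measure on `ℝ × M` that is invariant under translations of the first coordinate, and finite on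
the unit strip, is a product with Lebesgue measure. -/
lemma eq_volume_prod_of_map_translate_eq {μ : Measure (ℝ × M)}
    (h : ∀ t : ℝ, μ.map (fun z => (z.1 - t, z.2)) = μ) (hfin : μ (Ioc 0 1 ×ˢ univ) < ∞) :
    μ = (volume : Measure ℝ).prod ((μ.restrict (Ioc 0 1 ×ˢ univ)).map Prod.snd) := by
  have hfinm : IsFiniteMeasure (μ.restrict (Ioc (0 : ℝ) 1 ×ˢ (univ : Set M))) :=
    ⟨by rwa [Measure.restrict_apply_univ]⟩
  have hinv : ∀ (t : ℝ) (s : Set ℝ) (B : Set M), MeasurableSet s → MeasurableSet B →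
      μ (((fun u => u - t) ⁻¹' s) ×ˢ B) = μ (s ×ˢ B) := by
    intro t s B hs hB
    conv_rhs => rw [← h t, Measure.map_apply (measurable_translate t) (hs.prod hB)]
    rfl
  refine (Measure.prod_eq fun s B hs hB => ?_).symm
  -- For fixed `B`, the measure `s ↦ μ (s × B)` is translation invariant and locally finite, hence a
  -- multiple of Lebesgue measure; its value on `(0, 1]` gives the constant.
  set m : Measure ℝ := (μ.restrict (univ ×ˢ B)).map Prod.fst with hm
  have hmapp : ∀ s, MeasurableSet s → m s = μ (s ×ˢ B) := by
    intro s hs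
    rw [hm, Measure.map_apply measurable_fst hs, Measure.restrict_apply (measurable_fst hs)]
    congr 1
    ext z
    simp
  have hminv : m.IsAddLeftInvariant := by
    refine ⟨fun t => ?_⟩
    ext s hs
    rw [Measure.map_apply (by fun_prop) hs, hmapp _ hs,
      hmapp _ ((measurable_const_add t) hs), ← hinv (-t) s B hs hB]
    congr 2
    ext u
    simp [add_comm]
  have hmloc : IsLocallyFiniteMeasure m := by
    refine ⟨fun x => ⟨Ioc (x - 1 / 2) (x + 1 / 2), Ioc_mem_nhds (by linarith) (by linarith), ?_⟩⟩
    have h1 : (fun u => u - (x - 1 / 2)) ⁻¹' Ioc (0 : ℝ) 1 = Ioc (x - 1 / 2) (x + 1 / 2) := by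
      ext u
      simp only [mem_preimage, mem_Ioc]
      constructor <;> rintro ⟨h1, h2⟩ <;> constructor <;> linarith
    rw [hmapp _ measurableSet_Ioc, ← h1, hinv _ _ _ measurableSet_Ioc hB]
    exact (measure_mono (prod_mono_right (subset_univ _))).trans_lt hfin
  have hsc := Measure.isAddLeftInvariant_eq_smul m (volume : Measure ℝ)
  have h1 : m (Ioc 0 1) = Measure.addHaarScalarFactor m volume := by
    conv_lhs => rw [hsc, Measure.smul_apply, ENNReal.smul_def, smul_eq_mul]
    simp
  have h2 : m s = Measure.addHaarScalarFactor m volume * volume s := by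
    conv_lhs => rw [hsc, Measure.smul_apply, ENNReal.smul_def, smul_eq_mul]
  have h3 : Prod.snd ⁻¹' B ∩ Ioc (0 : ℝ) 1 ×ˢ univ = Ioc 0 1 ×ˢ B := by
    ext z
    simp [and_comm]
  rw [← hmapp s hs, h2, ← h1, hmapp _ measurableSet_Ioc, Measure.map_apply measurable_snd hB,
    Measure.restrict_apply (measurable_snd hB), mul_comm, h3]

/-- Since the mean measure is a product with Lebesgue measure, the displacement acts on each fibre
of constant mark `y` as the translation by `f y`, which preserves length. -/
lemma IsStationary.intensity_map_add {P : Measure Ω} {N : Ω → Measure (ℝ × M)}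
    (hst : IsStationary P N) (hN : AEMeasurable N P) (hfin : intensity P N univ < ∞) {f : M → ℝ}
    (hf : Measurable f) {B : Set M} (hB : MeasurableSet B) :
    intensity P (fun ω => (N ω).map (fun z => (z.1 + f z.2, z.2))) B = intensity P N B := by
  have hg : Measurable (fun z : ℝ × M => (z.1 + f z.2, z.2)) := by fun_prop
  have hI : MeasurableSet (Ioc (0 : ℝ) 1 ×ˢ B) := measurableSet_Ioc.prod hB
  have hfin' : meanMeasure P N (Ioc 0 1 ×ˢ univ) < ∞ := by
    rwa [meanMeasure_apply hN (measurableSet_Ioc.prod .univ)]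
  have hprod := eq_volume_prod_of_map_translate_eq (hst.map_meanMeasure hN) hfin'
  set ρ := ((meanMeasure P N).restrict (Ioc (0 : ℝ) 1 ×ˢ univ)).map Prod.snd with hρ
  have hρfin : IsFiniteMeasure ρ := by
    have : IsFiniteMeasure ((meanMeasure P N).restrict (Ioc (0 : ℝ) 1 ×ˢ (univ : Set M))) :=
      ⟨by rwa [Measure.restrict_apply_univ]⟩
    infer_instance
  have e1 : intensity P (fun ω => (N ω).map (fun z => (z.1 + f z.2, z.2))) B
      = meanMeasure P N ((fun z => (z.1 + f z.2, z.2)) ⁻¹' (Ioc 0 1 ×ˢ B)) := by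
    rw [meanMeasure_apply hN (hg hI), intensity]
    exact lintegral_congr fun ω => Measure.map_apply hg hI
  have e2 : intensity P N B = meanMeasure P N (Ioc 0 1 ×ˢ B) := by
    rw [meanMeasure_apply hN hI, intensity]
  rw [e1, e2, hprod, Measure.prod_prod, Measure.prod_apply_symm (hg hI)]
  have : ∀ y, volume ((fun x : ℝ => (x, y)) ⁻¹' ((fun z : ℝ × M => (z.1 + f z.2, z.2)) ⁻¹'
      (Ioc (0 : ℝ) 1 ×ˢ B))) = B.indicator (fun _ => (1 : ℝ≥0∞)) y := by
    intro y
    by_cases hy : y ∈ B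
    · have : (fun x : ℝ => (x, y)) ⁻¹' ((fun z : ℝ × M => (z.1 + f z.2, z.2)) ⁻¹'
          (Ioc (0 : ℝ) 1 ×ˢ B)) = Ioc (0 - f y) (1 - f y) := by
        ext x
        simp [hy, le_sub_iff_add_le, neg_lt_iff_pos_add]
      rw [this, Real.volume_Ioc]
      simp [hy]
    · have : (fun x : ℝ => (x, y)) ⁻¹' ((fun z : ℝ × M => (z.1 + f z.2, z.2)) ⁻¹'
          (Ioc (0 : ℝ) 1 ×ˢ B)) = ∅ := by
        ext x
        simp [hy]
      rw [this]
      simp [hy]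
  simp_rw [this]
  rw [lintegral_indicator hB]
  simp

/-- Disjoint events of equal probability are null. -/
lemma measure_eq_zero_of_pairwise_disjoint_of_eq {P : Measure Ω} [IsFiniteMeasure P]
    {E : ℤ → Set Ω} (hE : ∀ n, NullMeasurableSet (E n) P)
    (hd : Pairwise (Function.onFun Disjoint E)) (heq : ∀ n, P (E n) = P (E 0)) (n : ℤ) :
    P (E n) = 0 := by
  have h1 : ∑' n, P (E n) ≠ ∞ := by
    rw [← measure_iUnion₀ (hd.mono fun _ _ h => h.aedisjoint) hE]
    exact measure_ne_top _ _
  simp_rw [heq] at h1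
  rw [heq]
  by_contra h0
  exact h1 (ENNReal.tsum_const_eq_top_of_ne_zero h0)

/-- Stationarity gives all the events `shift n N ∈ A` the same probability and `hd` makes them
disjoint, so in a finite measure space they are null. Applied with `A` saying that the unit interval
`(0, 1]` is the last, or the first, to be charged. -/
lemma IsStationary.ae_forall_int_not_mem {P : Measure Ω} [IsFiniteMeasure P]
    {N : Ω → Measure (ℝ × M)} (hst : IsStationary P N) (hN : AEMeasurable N P)
    {A : Set (Measure (ℝ × M))} (hA : MeasurableSet A)
    (hd : ∀ ν, ∀ n m : ℤ, n < m → shift n ν ∈ A → shift m ν ∉ A) :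
    ∀ᵐ ω ∂P, ∀ n : ℤ, shift n (N ω) ∉ A := by
  rw [ae_all_iff]
  have hm : ∀ n : ℤ, AEMeasurable (fun ω => shift n (N ω)) P := fun n =>
    (measurable_shift (n : ℝ)).comp_aemeasurable hN
  have hE : ∀ n : ℤ, P {ω | shift n (N ω) ∈ A} = P.map N A := by
    intro n
    rw [← hst n, Measure.map_apply_of_aemeasurable (hm n) hA]
    rfl
  intro n
  rw [ae_iff]
  simp only [not_not]
  refine measure_eq_zero_of_pairwise_disjoint_of_eq (E := fun n : ℤ => {ω | shift n (N ω) ∈ A})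
    (fun n => (hm n).nullMeasurableSet_preimage hA) ?_ (fun n => (hE n).trans (hE 0).symm) n
  intro n m hnm
  rw [Function.onFun, Set.disjoint_left]
  intro ω h1 h2
  rcases lt_or_gt_of_ne hnm with h | h
  · exact hd _ _ _ h h1 h2
  · exact hd _ _ _ h h2 h1

/-- A stationary random measure has, almost surely, no last unit interval that it charges. -/
lemma IsStationary.ae_Ioi_ne_zero {P : Measure Ω} [IsFiniteMeasure P]
    {N : Ω → Measure (ℝ × M)} (hst : IsStationary P N) (hN : AEMeasurable N P) :
    ∀ᵐ ω ∂P, ∀ n : ℤ, N ω (Ioc (n : ℝ) (n + 1) ×ˢ univ) ≠ 0 → N ω (Ioi (n + 1 : ℝ) ×ˢ univ) ≠ 0 := by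
  let A : Set (Measure (ℝ × M)) :=
    {ν | ν (Ioc 0 1 ×ˢ univ) ≠ 0 ∧ ν (Ioi 1 ×ˢ univ) = 0}
  have hA : MeasurableSet A :=
    ((measurableSet_eq_fun (Measure.measurable_coe (measurableSet_Ioc.prod .univ))
      measurable_const).compl).inter
      (measurableSet_eq_fun (Measure.measurable_coe (measurableSet_Ioi.prod .univ)) measurable_const)
  have key : ∀ (n : ℤ) (ν : Measure (ℝ × M)), shift n ν ∈ A ↔
      ν (Ioc (n : ℝ) (n + 1) ×ˢ univ) ≠ 0 ∧ ν (Ioi (n + 1 : ℝ) ×ˢ univ) = 0 := by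
    intro n ν
    rw [mem_ofPred_eq, shift_apply _ _ measurableSet_Ioc .univ,
      shift_apply _ _ measurableSet_Ioi .univ]
    simp [add_comm]
  have hd : ∀ ν : Measure (ℝ × M), ∀ n m : ℤ, n < m → shift n ν ∈ A → shift m ν ∉ A := by
    intro ν n m hnm h1 h2
    rw [key] at h1 h2
    refine h2.1 (measure_mono_null (prod_mono_left fun u hu => ?_) h1.2)
    have : (n : ℝ) + 1 ≤ m := by exact_mod_cast hnm
    exact lt_of_le_of_lt this hu.1
  filter_upwards [hst.ae_forall_int_not_mem hN hA hd] with ω hω n h1 h2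
  exact hω n ((key n _).2 ⟨h1, h2⟩)

/-- A stationary random measure has, almost surely, no first unit interval that it charges. -/
lemma IsStationary.ae_Iic_ne_zero {P : Measure Ω} [IsFiniteMeasure P]
    {N : Ω → Measure (ℝ × M)} (hst : IsStationary P N) (hN : AEMeasurable N P) :
    ∀ᵐ ω ∂P, ∀ n : ℤ, N ω (Ioc (n : ℝ) (n + 1) ×ˢ univ) ≠ 0 → N ω (Iic (n : ℝ) ×ˢ univ) ≠ 0 := by
  let A : Set (Measure (ℝ × M)) :=
    {ν | ν (Ioc 0 1 ×ˢ univ) ≠ 0 ∧ ν (Iic 0 ×ˢ univ) = 0}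
  have hA : MeasurableSet A :=
    ((measurableSet_eq_fun (Measure.measurable_coe (measurableSet_Ioc.prod .univ))
      measurable_const).compl).inter
      (measurableSet_eq_fun (Measure.measurable_coe (measurableSet_Iic.prod .univ)) measurable_const)
  have key : ∀ (n : ℤ) (ν : Measure (ℝ × M)), shift n ν ∈ A ↔
      ν (Ioc (n : ℝ) (n + 1) ×ˢ univ) ≠ 0 ∧ ν (Iic (n : ℝ) ×ˢ univ) = 0 := by
    intro n ν
    rw [mem_ofPred_eq, shift_apply _ _ measurableSet_Ioc .univ,
      shift_apply _ _ measurableSet_Iic .univ]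
    simp [add_comm]
  have hd : ∀ ν : Measure (ℝ × M), ∀ n m : ℤ, n < m → shift n ν ∈ A → shift m ν ∉ A := by
    intro ν n m hnm h1 h2
    rw [key] at h1 h2
    refine h1.1 (measure_mono_null (prod_mono_left fun u hu => ?_) h2.2)
    have : (n : ℝ) + 1 ≤ m := by exact_mod_cast hnm
    exact hu.2.trans this
  filter_upwards [hst.ae_forall_int_not_mem hN hA hd] with ω hω n h1 h2
  exact hω n ((key n _).2 ⟨h1, h2⟩)

end

/-! ### Measurable thinning of a configuration, and covariance under translations. -/

section

/-- The strip `(j, j + 1] × M`. -/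
def strip (M : Type*) (j : ℤ) : Set (ℝ × M) := Ioc (j : ℝ) (j + 1) ×ˢ univ

variable {Ω M : Type*} [MeasurableSpace Ω]

lemma iUnion_strip : ⋃ j : ℤ, strip M j = univ := by
  simp_rw [strip, ← iUnion_prod_const, iUnion_Ioc_intCast, univ_prod_univ]

lemma pairwise_disjoint_strip : Pairwise (Function.onFun Disjoint (strip M)) := fun _ _ h =>
  (pairwise_disjoint_Ioc_intCast ℝ h).set_prod_left _ _

variable [MeasurableSpace M]

lemma measurableSet_strip (j : ℤ) : MeasurableSet (strip M j) := measurableSet_Ioc.prod .univ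

open Classical in
/-- The kernel `ν ↦ ν|strip`, cut to the event that the mass of the strip is in `[m, m + 1)`. -/
def stripKernel (M : Type*) [MeasurableSpace M] (i : ℤ × ℕ) :
    ProbabilityTheory.Kernel (Measure (ℝ × M)) (ℝ × M) where
  toFun ν := if ν (strip M i.1) ∈ Ico (i.2 : ℝ≥0∞) (i.2 + 1) then ν.restrict (strip M i.1) else 0
  measurable' := by
    refine Measurable.ite (Measure.measurable_coe (measurableSet_strip _) measurableSet_Ico) ?_
      measurable_const
    refine Measure.measurable_of_measurable_coe _ fun s hs => ?_
    simp_rw [Measure.restrict_apply hs]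
    exact Measure.measurable_coe (hs.inter (measurableSet_strip _))

instance (i : ℤ × ℕ) : ProbabilityTheory.IsFiniteKernel (stripKernel M i) := by
  refine ⟨⟨i.2 + 1, by simp, fun ν => ?_⟩⟩
  simp only [stripKernel, ProbabilityTheory.Kernel.coe_mk]
  split_ifs with h
  · rw [Measure.restrict_apply_univ]
    exact h.2.le
  · simp

/-- Cutting by strips and by levels of mass exhibits the identity `ν ↦ ν`, on locally finite
measures, as a countable sum of finite kernels. Measurability of sections under s-finite kernels
then applies to it. -/
lemma sum_stripKernel_apply {ν : Measure (ℝ × M)} (hν : ∀ j, ν (strip M j) < ∞) :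
    ProbabilityTheory.Kernel.sum (stripKernel M) ν = ν := by
  ext s hs
  rw [ProbabilityTheory.Kernel.sum_apply' _ _ hs, ENNReal.tsum_prod']
  have h1 : ∀ j : ℤ, ∑' m : ℕ, stripKernel M (j, m) ν s = ν (s ∩ strip M j) := by
    intro j
    -- Only the level containing the mass of the strip contributes, namely its integer part.
    rw [tsum_eq_single ⌊(ν (strip M j)).toNNReal⌋₊]
    · simp only [stripKernel, ProbabilityTheory.Kernel.coe_mk]
      rw [if_pos, Measure.restrict_apply hs]
      rw [← ENNReal.coe_toNNReal (hν j).ne, ENNReal.toNNReal_coe]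
      constructor
      · exact_mod_cast Nat.floor_le zero_le
      · exact_mod_cast Nat.lt_floor_add_one _
    · intro m hm
      simp only [stripKernel, ProbabilityTheory.Kernel.coe_mk]
      rw [if_neg]
      · simp
      · rw [← ENNReal.coe_toNNReal (hν j).ne]
        intro h
        refine hm ((Nat.floor_eq_iff zero_le).2 ⟨?_, ?_⟩).symm
        · exact_mod_cast h.1
        · exact_mod_cast h.2
  simp_rw [h1]
  rw [← measure_iUnion, ← inter_iUnion, iUnion_strip, inter_univ]
  · exact fun i j h => (pairwise_disjoint_strip h).mono inter_subset_right inter_subset_right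
  · exact fun j => hs.inter (measurableSet_strip j)

/-- Restricting a locally finite measure to a set that depends measurably on the measure is
a measurable operation. -/
lemma aemeasurable_restrict_section {L : Measure (Measure (ℝ × M))}
    (hL : ∀ᵐ ν ∂L, ∀ j, ν (strip M j) < ∞) {G : Set (Measure (ℝ × M) × (ℝ × M))}
    (hG : MeasurableSet G) :
    AEMeasurable (fun ν : Measure (ℝ × M) => ν.restrict (Prod.mk ν ⁻¹' G)) L := by
  refine ⟨fun ν => (ProbabilityTheory.Kernel.sum (stripKernel M) ν).restrict (Prod.mk ν ⁻¹' G),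
    ?_, ?_⟩
  · refine Measure.measurable_of_measurable_coe _ fun s hs => ?_
    simp_rw [Measure.restrict_apply hs]
    have : ∀ ν : Measure (ℝ × M), s ∩ Prod.mk ν ⁻¹' G = Prod.mk ν ⁻¹' ((univ ×ˢ s) ∩ G) := by
      intro ν
      ext z
      simp
    simp_rw [this]
    exact ProbabilityTheory.Kernel.measurable_kernel_prodMk_left
      ((MeasurableSet.univ.prod hs).inter hG)
  · filter_upwards [hL] with ν hν
    rw [sum_stripKernel_apply hν]

variable {K : ℕ}

/-- The pairs of a configuration and a packet of which the service is not interrupted. -/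
def uninterrupted (K : ℕ) : Set (Measure (ℝ × Mark K) × (ℝ × Mark K)) :=
  {p | p.1 (Ioo p.2.1 (p.2.1 + (p.2.2.2 : ℝ)) ×ˢ univ) = 0}

/-- An open interval with endpoints depending on the packet is null exactly when every rational
interval strictly inside it is; this leaves countably many conditions, each on a fixed interval. -/
lemma measurableSet_uninterrupted : MeasurableSet (uninterrupted K) := by
  have h : uninterrupted K = ⋂ (a : ℚ) (b : ℚ),
      ({p | p.1 (Ioo (a : ℝ) b ×ˢ univ) = 0} ∪
        {p | p.2.1 < (a : ℝ) ∧ (b : ℝ) < p.2.1 + (p.2.2.2 : ℝ)}ᶜ) := by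
    ext ⟨ν, z⟩
    simp only [uninterrupted, mem_ofPred_eq, mem_iInter, mem_union, mem_compl_iff]
    constructor
    · intro h a b
      by_cases hab : z.1 < (a : ℝ) ∧ (b : ℝ) < z.1 + (z.2.2 : ℝ)
      · exact .inl (measure_mono_null
          (prod_mono_left (Ioo_subset_Ioo hab.1.le hab.2.le)) h)
      · exact .inr hab
    · intro h
      have hsub : Ioo z.1 (z.1 + (z.2.2 : ℝ)) ×ˢ (univ : Set (Mark K)) ⊆
          ⋃ (a : ℚ) (b : ℚ) (_ : z.1 < (a : ℝ) ∧ (b : ℝ) < z.1 + (z.2.2 : ℝ)),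
            Ioo (a : ℝ) b ×ˢ univ := by
        rintro ⟨t, m⟩ ⟨ht, -⟩
        obtain ⟨a, ha1, ha2⟩ := exists_rat_btwn ht.1
        obtain ⟨b, hb1, hb2⟩ := exists_rat_btwn ht.2
        simp only [mem_iUnion]
        exact ⟨a, b, ⟨ha1, hb2⟩, ⟨ha2, hb1⟩, trivial⟩
      refine measure_mono_null hsub ?_
      simp only [measure_iUnion_null_iff]
      intro a b hab
      exact (h a b).resolve_right (not_not.2 hab)
  rw [h]
  refine .iInter fun a => .iInter fun b => .union ?_ (.compl ?_)
  · exact measurableSet_eq_fun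
      ((Measure.measurable_coe (measurableSet_Ioo.prod .univ)).comp measurable_fst) measurable_const
  · have h1 : Measurable fun p : Measure (ℝ × Mark K) × (ℝ × Mark K) => p.2.1 := by fun_prop
    have h2 : Measurable fun p : Measure (ℝ × Mark K) × (ℝ × Mark K) =>
      p.2.1 + (p.2.2.2 : ℝ) := by fun_prop
    exact (measurableSet_lt h1 measurable_const).inter (measurableSet_lt measurable_const h2)

/-- The sub-configuration of the packets of which the service is not interrupted. -/
def thin (ν : Measure (ℝ × Mark K)) : Measure (ℝ × Mark K) :=
  ν.restrict (Prod.mk ν ⁻¹' uninterrupted K)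

lemma thin_shift (t : ℝ) (ν : Measure (ℝ × Mark K)) : thin (shift t ν) = shift t (thin ν) := by
  have h : MeasurableSet (Prod.mk (shift t ν) ⁻¹' uninterrupted K) :=
    measurable_prodMk_left measurableSet_uninterrupted
  rw [thin, thin]
  conv_rhs => rw [shift]
  conv_lhs => enter [1]; rw [shift]
  rw [Measure.restrict_map (measurable_translate t) h]
  congr 2
  ext z
  simp only [mem_preimage, uninterrupted, mem_ofPred_eq]
  rw [shift_apply _ _ measurableSet_Ioo .univ]
  have : (fun u => u - t) ⁻¹' Ioo (z.1 - t) (z.1 - t + (z.2.2 : ℝ)) =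
      Ioo z.1 (z.1 + (z.2.2 : ℝ)) := by
    ext u
    simp only [mem_preimage, mem_Ioo]
    constructor <;> rintro ⟨h1, h2⟩ <;> constructor <;> linarith
  rw [this]

/-- The completion of an uninterrupted packet. -/
def complete (z : ℝ × Mark K) : ℝ × Mark K := (z.1 + (z.2.2 : ℝ), z.2)

lemma measurable_complete : Measurable (complete : ℝ × Mark K → ℝ × Mark K) := by
  unfold complete
  fun_prop

lemma map_complete_shift (t : ℝ) (ν : Measure (ℝ × Mark K)) :
    (shift t ν).map complete = shift t (ν.map complete) := by
  rw [shift, shift, Measure.map_map measurable_complete (measurable_translate t),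
    Measure.map_map (measurable_translate t) measurable_complete]
  congr 1
  ext z
  · simp only [complete, Function.comp_apply]
    ring
  all_goals rfl

/-- An almost surely measurable operation that commutes with translations preserves stationarity. -/
lemma IsStationary.comp {M' : Type*} [MeasurableSpace M'] {P : Measure Ω}
    {N : Ω → Measure (ℝ × M)} (hst : IsStationary P N) (hN : AEMeasurable N P)
    {F : Measure (ℝ × M) → Measure (ℝ × M')} (hF : AEMeasurable F (P.map N))
    (hFs : ∀ t ν, F (shift t ν) = shift t (F ν)) : IsStationary P (fun ω => F (N ω)) := by
  intro t
  have hm : AEMeasurable (fun ω => shift t (N ω)) P := (measurable_shift t).comp_aemeasurable hN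
  simp_rw [← hFs]
  -- `F` is only almost everywhere measurable for the law of `N`; the translated process has the
  -- same law, so this suffices for it too.
  have e1 := AEMeasurable.map_map_of_aemeasurable (by rwa [hst t]) hm (g := F)
  have e2 := AEMeasurable.map_map_of_aemeasurable hF hN
  rw [hst t] at e1
  exact e1.symm.trans e2

lemma IsNumberedProcess.ae_strip_lt_top {P : Measure Ω} {N : Ω → Measure (ℝ × M)}
    {X : ℤ → Ω → ℝ × M} (h : IsNumberedProcess P N X) :
    ∀ᵐ ν ∂(P.map N), ∀ j, ν (strip M j) < ∞ := by
  rw [ae_map_iff h.measurable.aemeasurable]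
  · filter_upwards [h.locallyFinite] with ω hω j
    exact (measure_mono (prod_mono_left Ioc_subset_Icc_self)).trans_lt (hω _ _)
  · have : {ν : Measure (ℝ × M) | ∀ j, ν (strip M j) < ∞} = ⋂ j, {ν | ν (strip M j) < ∞} := by
      ext; simp
    rw [this]
    exact .iInter fun j =>
      measurableSet_lt (Measure.measurable_coe (measurableSet_strip j)) measurable_const

lemma IsNumberedProcess.aemeasurable_thin {P : Measure Ω} {N : Ω → Measure (ℝ × Mark K)}
    {X : ℤ → Ω → ℝ × Mark K} (h : IsNumberedProcess P N X) : AEMeasurable thin (P.map N) :=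
  aemeasurable_restrict_section h.ae_strip_lt_top measurableSet_uninterrupted

end

/-! ### Measurable enumeration of a doubly unbounded set of integers. -/

section

section Indexing

/-- The increasing enumeration of `{n | c n}` by `ℤ`, number `1` being the first element
in `[a, ∞)`. -/
def enumerate (a : ℤ) (c : ℤ → Prop) (k : ℤ) : ℤ :=
  if 0 < k then a + Nat.nth (fun j => c (a + j)) (k - 1).toNat
  else a - 1 - Nat.nth (fun j => c (a - 1 - j)) (-k).toNat

variable {a : ℤ} {c : ℤ → Prop}

lemma infinite_right (a : ℤ) (hu : ∀ m, ∃ n, m < n ∧ c n) :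
    (Set.ofPred fun j : ℕ => c (a + j)).Infinite := by
  refine Set.infinite_of_forall_exists_gt fun b => ?_
  obtain ⟨n, hn, hc⟩ := hu (a + b)
  refine ⟨(n - a).toNat, ?_, by omega⟩
  change c (a + ((n - a).toNat : ℤ))
  rwa [Int.toNat_of_nonneg (by omega), add_sub_cancel]

lemma infinite_left (a : ℤ) (hl : ∀ m, ∃ n, n < m ∧ c n) :
    (Set.ofPred fun j : ℕ => c (a - 1 - j)).Infinite := by
  refine Set.infinite_of_forall_exists_gt fun b => ?_
  obtain ⟨n, hn, hc⟩ := hl (a - 1 - b)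
  refine ⟨(a - 1 - n).toNat, ?_, by omega⟩
  change c (a - 1 - ((a - 1 - n).toNat : ℤ))
  rwa [Int.toNat_of_nonneg (by omega), sub_sub_cancel]

lemma enumerate_zero_lt : enumerate a c 0 < a := by
  simp only [enumerate, lt_irrefl, if_false]
  omega

lemma le_enumerate_one : a ≤ enumerate a c 1 := by
  simp [enumerate]

lemma strictMono_enumerate (hu : ∀ m, ∃ n, m < n ∧ c n) (hl : ∀ m, ∃ n, n < m ∧ c n) :
    StrictMono (enumerate a c) := by
  intro k l hkl
  simp only [enumerate]
  split_ifs with h1 h2 h2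
  · have := Nat.nth_strictMono (infinite_right a hu)
      (show (k - 1).toNat < (l - 1).toNat by omega)
    omega
  · omega
  · omega
  · have := Nat.nth_strictMono (infinite_left a hl) (show (-l).toNat < (-k).toNat by omega)
    omega

lemma range_enumerate (hu : ∀ m, ∃ n, m < n ∧ c n) (hl : ∀ m, ∃ n, n < m ∧ c n) (n : ℤ) :
    n ∈ range (enumerate a c) ↔ c n := by
  constructor
  · rintro ⟨k, rfl⟩
    simp only [enumerate]
    split_ifs
    · exact Nat.nth_mem_of_infinite (infinite_right a hu) _
    · exact Nat.nth_mem_of_infinite (infinite_left a hl) _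
  · intro hc
    rcases le_or_gt a n with h | h
    · have hmem : (n - a).toNat ∈ range (Nat.nth fun j : ℕ => c (a + j)) := by
        rw [Nat.range_nth_of_infinite (infinite_right a hu)]
        change c (a + ((n - a).toNat : ℤ))
        rwa [Int.toNat_of_nonneg (by omega), add_sub_cancel]
      obtain ⟨i, hi⟩ := hmem
      refine ⟨i + 1, ?_⟩
      rw [enumerate, if_pos (by omega), show ((i : ℤ) + 1 - 1).toNat = i by omega, hi]
      omega
    · have hmem : (a - 1 - n).toNat ∈ range (Nat.nth fun j : ℕ => c (a - 1 - j)) := by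
        rw [Nat.range_nth_of_infinite (infinite_left a hl)]
        change c (a - 1 - ((a - 1 - n).toNat : ℤ))
        rwa [Int.toNat_of_nonneg (by omega), sub_sub_cancel]
      obtain ⟨i, hi⟩ := hmem
      refine ⟨-i, ?_⟩
      rw [enumerate, if_neg (by omega), show (-(-(i : ℤ))).toNat = i by omega, hi]
      omega

variable {Ω : Type*} [MeasurableSpace Ω]

lemma measurable_sInf_nat {p : Ω → ℕ → Prop} (hp : ∀ n, MeasurableSet {ω | p ω n}) :
    Measurable fun ω => sInf {n | p ω n} := by
  refine measurable_to_countable' fun n => ?_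
  -- The second set of the union accounts for the convention `sInf ∅ = 0`.
  have h : (fun ω => sInf {n | p ω n}) ⁻¹' {n} =
      ({ω | p ω n} ∩ ⋂ k, ⋂ (_ : k < n), {ω | p ω k}ᶜ) ∪
        {ω | n = 0 ∧ ∀ k, ω ∈ {ω | p ω k}ᶜ} := by
    ext ω
    simp only [mem_preimage, mem_singleton_iff, mem_union, mem_inter_iff, mem_iInter,
      mem_compl_iff, mem_ofPred_eq]
    constructor
    · intro h
      rcases Set.eq_empty_or_nonempty {n | p ω n} with h0 | h0
      · right
        rw [h0, Nat.sInf_empty] at h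
        exact ⟨h.symm, fun k hk => (h0 ▸ (show k ∈ {n | p ω n} from hk) : k ∈ (∅ : Set ℕ))⟩
      · left
        subst h
        exact ⟨Nat.sInf_mem h0, fun k hk => Nat.notMem_of_lt_sInf hk⟩
    · rintro (⟨h1, h2⟩ | ⟨rfl, h2⟩)
      · refine le_antisymm (Nat.sInf_le h1) ?_
        by_contra! h3
        exact h2 _ h3 (Nat.sInf_mem ⟨n, h1⟩)
      · have : {n | p ω n} = ∅ := eq_empty_of_forall_notMem h2
        rw [this, Nat.sInf_empty]
  rw [h]
  refine .union ((hp n).inter (.iInter fun k => .iInter fun _ => (hp k).compl)) ?_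
  by_cases hn : n = 0
  · simp only [hn, true_and]
    have : {ω | ∀ k, ω ∈ {ω | p ω k}ᶜ} = ⋂ k, {ω | p ω k}ᶜ := by
      ext ω
      simp
    rw [this]
    exact .iInter fun k => (hp k).compl
  · simp [hn]

/-- The `n`-th element is the least one exceeding all its predecessors, which are measurable by
strong induction. -/
lemma measurable_nth {p : Ω → ℕ → Prop} (hp : ∀ n, MeasurableSet {ω | p ω n}) (n : ℕ) :
    Measurable fun ω => Nat.nth (p ω) n := by
  induction n using Nat.strong_induction_on with
  | _ n ih =>
    simp_rw [Nat.nth_eq_sInf _ n]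
    refine measurable_sInf_nat fun x => ?_
    have : {ω | p ω x ∧ ∀ k < n, Nat.nth (p ω) k < x} =
        {ω | p ω x} ∩ ⋂ k, ⋂ (_ : k < n), {ω | Nat.nth (p ω) k < x} := by
      ext ω
      simp
    rw [this]
    exact (hp x).inter (.iInter fun k => .iInter fun hk => measurableSet_lt (ih k hk)
      measurable_const)

lemma measurable_enumerate {a : Ω → ℤ} (ha : Measurable a) {c : Ω → ℤ → Prop}
    (hc : ∀ n, MeasurableSet {ω | c ω n}) (k : ℤ) :
    Measurable fun ω => enumerate (a ω) (c ω) k := by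
  -- The random starting index takes countably many values, so the event splits according to its
  -- value.
  have hset : ∀ f : ℤ → ℤ, MeasurableSet {ω | c ω (f (a ω))} := by
    intro f
    have : {ω | c ω (f (a ω))} = ⋃ i, a ⁻¹' {i} ∩ {ω | c ω (f i)} := by
      ext ω
      simp
    rw [this]
    exact .iUnion fun i => (ha (measurableSet_singleton i)).inter (hc _)
  simp only [enumerate]
  split_ifs
  · exact ha.add (measurable_from_top.comp
      (measurable_nth (p := fun ω j => c ω (a ω + j)) (fun n => hset (fun i => i + n)) _))
  · exact (ha.sub_const 1).sub (measurable_from_top.comp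
      (measurable_nth (p := fun ω j => c ω (a ω - 1 - j)) (fun n => hset (fun i => i - 1 - n)) _))

end Indexing

end

/-! ### Completed packets of a fixed realization: order, local finiteness, numbering. -/

section

variable {K : ℕ}

section Thinned

variable {ι M : Type*} [MeasurableSpace M] {c : ι → Prop} {y : ι → M}

open Classical in
/-- The counting measure of the points `y n` that satisfy `c n`. -/
def thinned (c : ι → Prop) (y : ι → M) : Measure M :=
  Measure.sum fun n => if c n then Measure.dirac (y n) else 0

open Classical in
lemma thinned_apply {s : Set M} (hs : MeasurableSet s) :
    thinned c y s = ∑' n, if c n ∧ y n ∈ s then 1 else 0 := by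
  rw [thinned, Measure.sum_apply _ hs]
  refine tsum_congr fun n => ?_
  by_cases h1 : c n <;> by_cases h2 : y n ∈ s <;> simp [h1, h2, Measure.dirac_apply' _ hs]

lemma thinned_apply_ne_zero {s : Set M} (hs : MeasurableSet s) :
    thinned c y s ≠ 0 ↔ ∃ n, c n ∧ y n ∈ s := by
  rw [thinned_apply hs, Ne, ENNReal.tsum_eq_zero]
  simp

lemma map_thinned {M' : Type*} [MeasurableSpace M'] {f : M → M'} (hf : Measurable f) :
    (thinned c y).map f = thinned c (fun n => f (y n)) := by
  ext s hs
  rw [Measure.map_apply hf hs, thinned_apply (hf hs), thinned_apply hs]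
  rfl

lemma restrict_sum_dirac {s : Set M} (hs : MeasurableSet s) (hc : ∀ n, c n ↔ y n ∈ s) :
    (Measure.sum fun n => Measure.dirac (y n)).restrict s = thinned c y := by
  ext t ht
  rw [Measure.restrict_apply ht, Measure.sum_apply _ (ht.inter hs), thinned_apply ht]
  refine tsum_congr fun n => ?_
  rw [Measure.dirac_apply' _ (ht.inter hs)]
  by_cases h1 : y n ∈ s <;> by_cases h2 : y n ∈ t <;> simp [h1, h2, hc]

lemma thinned_eq_sum_dirac {κ : Type*} {σ : κ → ι} (hσ : Function.Injective σ)
    (hr : ∀ n, n ∈ range σ ↔ c n) :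
    thinned c y = Measure.sum fun k => Measure.dirac (y (σ k)) := by
  classical
  ext s hs
  rw [thinned_apply hs, Measure.sum_apply _ hs, ← hσ.tsum_eq]
  · refine tsum_congr fun k => ?_
    have : c (σ k) := (hr _).1 ⟨k, rfl⟩
    by_cases h2 : y (σ k) ∈ s <;> simp [this, h2, Measure.dirac_apply' _ hs]
  · intro n hn
    rw [hr]
    by_contra h
    simp [h] at hn

lemma thinned_lt_top {s : Set M} (hs : MeasurableSet s) (hfin : {n | c n ∧ y n ∈ s}.Finite) :
    thinned c y s < ∞ := by
  classical
  rw [thinned_apply hs, tsum_eq_sum (s := hfin.toFinset)]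
  · refine ENNReal.sum_lt_top.2 fun n _ => ?_
    split_ifs <;> simp
  · intro n hn
    rw [if_neg]
    simpa using hn

end Thinned

variable {ν : Measure (ℝ × Mark K)} {x : ℤ → ℝ × Mark K}

/-- Point `n + 1` is the first one after point `n`, so the open interval of service is empty exactly
when it ends no later than that point. Openness excludes the packet itself and allows completion at
the very instant of the next generation. -/
lemma thin_eq_thinned (hν : ν = Measure.sum fun n => Measure.dirac (x n))
    (hx : StrictMono fun n => (x n).1) : thin ν = thinned (Completed x) x := by
  have hG : MeasurableSet (Prod.mk ν ⁻¹' uninterrupted K) :=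
    measurable_prodMk_left measurableSet_uninterrupted
  have hc : ∀ n, Completed x n ↔ x n ∈ Prod.mk ν ⁻¹' uninterrupted K := by
    intro n
    have hI : MeasurableSet (Ioo (x n).1 ((x n).1 + ((x n).2.2 : ℝ)) ×ˢ (univ : Set (Mark K))) :=
      measurableSet_Ioo.prod .univ
    simp only [mem_preimage, uninterrupted, mem_ofPred_eq]
    rw [hν, Measure.sum_apply _ hI, ENNReal.tsum_eq_zero]
    simp only [Measure.dirac_apply' _ hI, indicator_apply_eq_zero, mem_prod, mem_univ, and_true,
      Pi.one_apply, one_ne_zero, imp_false, mem_Ioo, not_and, not_lt, Completed]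
    constructor
    · intro h m hm
      have : (x (n + 1)).1 ≤ (x m).1 := hx.monotone (show n + 1 ≤ m from hx.lt_iff_lt.1 hm)
      linarith
    · intro h
      have := h (n + 1) (hx (lt_add_one n))
      linarith
  rw [thin]
  generalize Prod.mk ν ⁻¹' uninterrupted K = G at hG hc
  rw [hν]
  exact restrict_sum_dirac hG hc

lemma complete_le_of_lt (hx : StrictMono fun n => (x n).1) {n m : ℤ} (hn : Completed x n)
    (hnm : n < m) : (complete (x n)).1 ≤ (x m).1 := by
  have h1 : (x (n + 1)).1 ≤ (x m).1 := hx.monotone hnm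
  simp only [Completed] at hn
  simp only [complete]
  linarith

lemma le_complete (z : ℝ × Mark K) : z.1 ≤ (complete z).1 := by
  simp [complete]

/-- If a further point lies strictly between `n` and `m`, strictness comes from the generation
times. For `m = n + 1`, equality would force `Sₙ = τₙ` and `Sₙ₊₁ = 0`, the excluded tie. Packet `m`
need not be completed. -/
lemma complete_lt_complete (hx : StrictMono fun n => (x n).1)
    (hties : ∀ n, ¬(((x n).2.2 : ℝ) = (x (n + 1)).1 - (x n).1 ∧ (x (n + 1)).2.2 = 0))
    {n m : ℤ} (hn : Completed x n) (hnm : n < m) :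
    (complete (x n)).1 < (complete (x m)).1 := by
  rcases (show n + 1 ≤ m from hnm).eq_or_lt with rfl | h
  · refine ((complete_le_of_lt hx hn hnm).trans (le_complete _)).lt_of_ne fun h => ?_
    have h1 := complete_le_of_lt hx hn hnm
    have h2 := le_complete (x (n + 1))
    simp only [complete] at h h1 h2
    refine hties n ⟨by linarith, NNReal.coe_eq_zero.1 (by linarith)⟩
  · exact ((complete_le_of_lt hx hn (lt_add_one n)).trans_lt (hx h)).trans_le (le_complete _)

/-- A packet completed in `[a, b]` is generated in `[a, b]`, or before `a` with its successor at or
after `a`. The first kind is finite in number by local finiteness, and there is at most one of the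
second. -/
lemma thinned_complete_Icc_lt_top (hν : ν = Measure.sum fun n => Measure.dirac (x n))
    (hx : StrictMono fun n => (x n).1) (hfin : ∀ a b : ℝ, ν (Icc a b ×ˢ univ) < ∞) (a b : ℝ) :
    thinned (Completed x) (fun n => complete (x n)) (Icc a b ×ˢ univ) < ∞ := by
  have hI : MeasurableSet (Icc a b ×ˢ (univ : Set (Mark K))) := measurableSet_Icc.prod .univ
  refine thinned_lt_top hI ?_
  have h1 : {n | (x n).1 ∈ Icc a b}.Finite := by
    have h := (hfin a b).ne
    rw [hν, Measure.sum_apply _ hI] at h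
    refine (ENNReal.finite_const_le_of_tsum_ne_top h one_ne_zero).subset fun n hn => ?_
    have hn' : x n ∈ Icc a b ×ˢ (univ : Set (Mark K)) := ⟨hn, trivial⟩
    simp [Measure.dirac_apply' _ hI, hn', indicator_of_mem]
  have h2 : {n | (x n).1 < a ∧ a ≤ (x (n + 1)).1}.Finite := by
    refine Set.Subsingleton.finite fun n hn m hm => ?_
    have h3 := hx.lt_iff_lt.1 (hn.1.trans_le hm.2)
    have h4 := hx.lt_iff_lt.1 (hm.1.trans_le hn.2)
    omega
  refine (h1.union h2).subset ?_
  rintro n ⟨hn, ⟨ha, hb⟩, -⟩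
  rcases le_or_gt a (x n).1 with h | h
  · exact .inl ⟨h, (le_complete _).trans hb⟩
  · exact .inr ⟨h, ha.trans (complete_le_of_lt hx hn (lt_add_one n))⟩

section Unbounded

variable {c : ℤ → Prop} {y : ℤ → ℝ × Mark K}

lemma exists_mem_Ioc_int (u : ℝ) : ∃ j : ℤ, u ∈ Ioc (j : ℝ) (j + 1) :=
  ⟨⌈u⌉ - 1, by push_cast; linarith [Int.ceil_lt_add_one u], by
    push_cast; linarith [Int.le_ceil u]⟩

/-- Otherwise there is a last index `b` satisfying `c`. The unit interval of its point is charged,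
so some point lies beyond that interval; but its index is at most `b`, so by monotonicity it cannot
be later than point `b`. -/
lemma exists_gt_of_thinned (hmono : ∀ n m, c n → n < m → (y n).1 < (y m).1)
    (h : ∀ j : ℤ, thinned c y (Ioc (j : ℝ) (j + 1) ×ˢ univ) ≠ 0 →
      thinned c y (Ioi (j + 1 : ℝ) ×ˢ univ) ≠ 0)
    (hne : ∃ n, c n) (m : ℤ) : ∃ n, m < n ∧ c n := by
  by_contra! hm
  obtain ⟨b, hb, hmax⟩ := Int.exists_greatest_of_bdd
    ⟨m, fun z hz => not_lt.1 fun h => hm z h hz⟩ hne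
  obtain ⟨j, hj⟩ := exists_mem_Ioc_int (y b).1
  obtain ⟨n, hn, hn1, -⟩ := (thinned_apply_ne_zero (measurableSet_Ioi.prod .univ)).1
    (h j ((thinned_apply_ne_zero (measurableSet_Ioc.prod .univ)).2 ⟨b, hb, hj, trivial⟩))
  rcases (hmax n hn).eq_or_lt with rfl | hlt
  · exact absurd hj.2 (not_le.2 hn1)
  · exact absurd hj.2 (not_le.2 (lt_trans hn1 (hmono n b hn hlt)))

lemma exists_lt_of_thinned (hmono : ∀ n m, c n → n < m → (y n).1 < (y m).1)
    (h : ∀ j : ℤ, thinned c y (Ioc (j : ℝ) (j + 1) ×ˢ univ) ≠ 0 →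
      thinned c y (Iic (j : ℝ) ×ˢ univ) ≠ 0)
    (hne : ∃ n, c n) (m : ℤ) : ∃ n, n < m ∧ c n := by
  by_contra! hm
  obtain ⟨b, hb, hmin⟩ := Int.exists_least_of_bdd
    ⟨m, fun z hz => not_lt.1 fun h => hm z h hz⟩ hne
  obtain ⟨j, hj⟩ := exists_mem_Ioc_int (y b).1
  obtain ⟨n, hn, hn1, -⟩ := (thinned_apply_ne_zero (measurableSet_Iic.prod .univ)).1
    (h j ((thinned_apply_ne_zero (measurableSet_Ioc.prod .univ)).2 ⟨b, hb, hj, trivial⟩))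
  rcases (hmin n hn).eq_or_lt with rfl | hlt
  · exact absurd hj.1 (not_lt.2 hn1)
  · exact absurd hj.1 (not_lt.2 ((hmono b n hb hlt).le.trans hn1))

end Unbounded

/-- The number of the first input packet that cannot be completed in `(-∞, 0]`. -/
def firstPositive (x : ℤ → ℝ × Mark K) : ℤ := if (complete (x 0)).1 ≤ 0 then 1 else 0

/-- The completed packets, numbered by their completion times. -/
def completions (x : ℤ → ℝ × Mark K) (k : ℤ) : ℝ × Mark K :=
  complete (x (enumerate (firstPositive x) (Completed x) k))

lemma complete_nonpos_of_lt_firstPositive (hx : StrictMono fun n => (x n).1)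
    (h0 : (x 0).1 ≤ 0) {n : ℤ} (hn : Completed x n) (h : n < firstPositive x) :
    (complete (x n)).1 ≤ 0 := by
  rcases lt_or_ge n 0 with h1 | h1
  · exact (complete_le_of_lt hx hn h1).trans h0
  · rw [firstPositive] at h
    split_ifs at h with h2
    · rwa [show n = 0 by omega]
    · omega

lemma complete_pos_of_firstPositive_le (hx : StrictMono fun n => (x n).1)
    (h1 : 0 < (x 1).1) {n : ℤ} (h : firstPositive x ≤ n) : 0 < (complete (x n)).1 := by
  rcases lt_or_ge 0 n with h2 | h2
  · exact (h1.trans_le (hx.monotone h2)).trans_le (le_complete _)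
  · rw [firstPositive] at h
    split_ifs at h with h3
    · omega
    · rw [show n = 0 by omega]
      exact not_le.1 h3

end

/-! ### Palm probabilities and intensities as sums over the numbered points. -/

section

variable {Ω M : Type*} [MeasurableSpace Ω] [MeasurableSpace M] {P : Measure Ω}
  {N : Ω → Measure (ℝ × M)} {X : ℤ → Ω → ℝ × M}

lemma lintegral_thinned {c : Ω → ℤ → Prop} (hc : ∀ n, MeasurableSet {ω | c ω n})
    (hX : ∀ n, Measurable (X n)) {s : Set (ℝ × M)} (hs : MeasurableSet s) :
    ∫⁻ ω, thinned (c ω) (fun n => X n ω) s ∂P = ∑' n, P {ω | c ω n ∧ X n ω ∈ s} := by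
  classical
  have hm : ∀ n, MeasurableSet {ω | c ω n ∧ X n ω ∈ s} := fun n => (hc n).inter (hX n hs)
  simp_rw [thinned_apply hs]
  rw [lintegral_tsum fun n => (Measurable.ite (hm n) measurable_const measurable_const).aemeasurable]
  refine tsum_congr fun n => ?_
  rw [← lintegral_indicator_one (hm n)]
  refine lintegral_congr fun ω => ?_
  simp [indicator_apply]

lemma measurableSet_ne_zero (hN : Measurable N) : MeasurableSet {ω | N ω ≠ 0} := by
  have : {ω | N ω ≠ 0} = {ω | N ω univ = 0}ᶜ := by
    ext ω
    simp [Measure.measure_univ_eq_zero]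
  rw [this]
  exact ((Measure.measurable_coe .univ).comp hN (measurableSet_singleton 0)).compl

namespace IsNumberedProcess

lemma ae_eq_thinned (h : IsNumberedProcess P N X) :
    ∀ᵐ ω ∂P, N ω = thinned (fun _ => N ω ≠ 0) (fun n => X n ω) := by
  filter_upwards [h.eq_sum] with ω hω
  by_cases h0 : N ω = 0
  · simp [thinned, h0]
  · simp only [thinned, ne_eq, h0, not_false_eq_true, if_true]
    exact hω h0

lemma intensity_eq_tsum (h : IsNumberedProcess P N X) {B : Set M} (hB : MeasurableSet B) :
    intensity P N B = ∑' n, P {ω | N ω ≠ 0 ∧ (X n ω).1 ∈ Ioc (0 : ℝ) 1 ∧ (X n ω).2 ∈ B} := by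
  rw [intensity, lintegral_congr_ae (h.ae_eq_thinned.mono fun ω hω =>
    congrArg (fun ν : Measure (ℝ × M) => ν (Ioc 0 1 ×ˢ B)) hω)]
  exact lintegral_thinned (c := fun ω _ => N ω ≠ 0) (fun _ => measurableSet_ne_zero h.measurable)
    h.measurable_point (measurableSet_Ioc.prod hB)

lemma measurable_recentre (h : IsNumberedProcess P N X) (n : ℤ) :
    Measurable fun ω => recentre n (fun j => X j ω) := by
  have := h.measurable_point
  unfold recentre
  fun_prop

lemma palm_apply (h : IsNumberedProcess P N X) (B : Set M)
    {A : Set (ℤ → ℝ × M)} (hA : MeasurableSet A) :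
    palm P N X B A = (intensity P N B)⁻¹ *
      ∑' n, P {ω | (N ω ≠ 0 ∧ (X n ω).1 ∈ Ioc (0 : ℝ) 1 ∧ (X n ω).2 ∈ B) ∧
        recentre n (fun j => X j ω) ∈ A} := by
  rw [palm, Measure.smul_apply, smul_eq_mul, Measure.sum_apply _ hA]
  congr 1
  refine tsum_congr fun n => ?_
  rw [Measure.map_apply (h.measurable_recentre n) hA, Measure.restrict_apply
    (h.measurable_recentre n hA), inter_comm]
  rfl

lemma intensity_mul_palm (h : IsNumberedProcess P N X) {B : Set M} (hB : MeasurableSet B)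
    (hfin : intensity P N B < ∞) {A : Set (ℤ → ℝ × M)} (hA : MeasurableSet A) :
    intensity P N B * palm P N X B A =
      ∑' n, P {ω | (N ω ≠ 0 ∧ (X n ω).1 ∈ Ioc (0 : ℝ) 1 ∧ (X n ω).2 ∈ B) ∧
        recentre n (fun j => X j ω) ∈ A} := by
  rw [h.palm_apply B hA]
  -- At intensity zero the normalizing inverse is infinite, but both sides vanish: every event in
  -- the sum is null.
  rcases eq_or_ne (intensity P N B) 0 with h0 | h0
  · rw [h0, zero_mul, eq_comm, ENNReal.tsum_eq_zero]
    rw [h.intensity_eq_tsum hB, ENNReal.tsum_eq_zero] at h0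
    exact fun n => measure_mono_null (fun ω hω => hω.1) (h0 n)
  · rw [← mul_assoc, ENNReal.mul_inv_cancel h0 hfin.ne, one_mul]

lemma palm_univ (h : IsNumberedProcess P N X) {B : Set M} (hB : MeasurableSet B)
    (h0 : intensity P N B ≠ 0) (hfin : intensity P N B < ∞) : palm P N X B univ = 1 := by
  rw [h.palm_apply B .univ]
  simp only [mem_univ, and_true]
  rw [← h.intensity_eq_tsum hB, ENNReal.inv_mul_cancel h0 hfin.ne]

end IsNumberedProcess

variable {K : ℕ}

lemma measurableSet_ofSource (k : Fin K) : MeasurableSet (ofSource k) :=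
  (measurableSet_singleton k).prod .univ

lemma measurableSet_sourceZero (k : Fin K) : MeasurableSet (sourceZero k) := by
  have : Measurable fun x : ℤ → ℝ × Mark K => (x 0).2.1 := by fun_prop
  exact this (measurableSet_singleton k)

lemma measurableSet_completedZero : MeasurableSet (completedZero K) :=
  measurableSet_le (by fun_prop) (by fun_prop)

lemma recentre_mem_completedZero (n : ℤ) (x : ℤ → ℝ × Mark K) :
    recentre n x ∈ completedZero K ↔ Completed x n := by
  simp [recentre, completedZero, Completed]

lemma recentre_mem_sourceZero (n : ℤ) (x : ℤ → ℝ × Mark K) (k : Fin K) :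
    recentre n x ∈ sourceZero k ↔ (x n).2 ∈ ofSource k := by
  simp [recentre, sourceZero, ofSource]

lemma sum_ofSource (μ : Measure (ℝ × Mark K)) (s : Set ℝ) (hs : MeasurableSet s) :
    ∑ k : Fin K, μ (s ×ˢ ofSource k) = μ (s ×ˢ univ) := by
  rw [← measure_biUnion_finset _ fun k _ => hs.prod (measurableSet_ofSource k)]
  · congr 1
    ext z
    simp [ofSource]
  · intro i _ j _ hij
    rw [Function.onFun, Set.disjoint_left]
    rintro z ⟨-, hi, -⟩ ⟨-, hj, -⟩
    exact hij (hi.symm.trans hj)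

lemma sum_intensity_ofSource {N : Ω → Measure (ℝ × Mark K)} (hN : AEMeasurable N P) :
    ∑ k : Fin K, intensity P N (ofSource k) = intensity P N univ := by
  simp only [intensity]
  rw [← lintegral_finsetSum' (f := fun k ω => N ω (Ioc 0 1 ×ˢ ofSource k)) _ fun k _ =>
    (Measure.measurable_coe (measurableSet_Ioc.prod (measurableSet_ofSource k))).comp_aemeasurable hN]
  exact lintegral_congr fun ω => sum_ofSource _ _ measurableSet_Ioc

/-! ### The output process: stationarity, rates and numbering. -/

section PushoutOutput

variable {Φ : Ω → Measure (ℝ × Mark K)} {X : ℤ → Ω → ℝ × Mark K}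

lemma intensity_mono (N : Ω → Measure (ℝ × M)) {B C : Set M} (h : B ⊆ C) :
    intensity P N B ≤ intensity P N C :=
  lintegral_mono fun _ => measure_mono (prod_mono_right h)

lemma IsNumberedProcess.intensity_ofSource (h : IsNumberedProcess P Φ X)
    (hfin : intensity P Φ univ < ∞) (k : Fin K) :
    intensity P Φ univ * palm P Φ X univ (sourceZero k) = intensity P Φ (ofSource k) := by
  rw [h.intensity_mul_palm .univ hfin (measurableSet_sourceZero k),
    h.intensity_eq_tsum (measurableSet_ofSource k)]
  simp only [recentre_mem_sourceZero, mem_univ, and_true, and_assoc]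

/-- Both sides are the expected number of source `k` packets generated in `(0, 1]` that are
completed. -/
lemma IsNumberedProcess.intensity_completed_sourceZero (h : IsNumberedProcess P Φ X)
    (hfin : intensity P Φ univ < ∞) (k : Fin K) :
    intensity P Φ univ * palm P Φ X univ (completedZero K ∩ sourceZero k) =
      intensity P Φ (ofSource k) * palm P Φ X (ofSource k) (completedZero K) := by
  rw [h.intensity_mul_palm .univ hfin
      (measurableSet_completedZero.inter (measurableSet_sourceZero k)),
    h.intensity_mul_palm (measurableSet_ofSource k)
      ((intensity_mono _ (subset_univ _)).trans_lt hfin) measurableSet_completedZero]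
  refine tsum_congr fun n => congrArg P ?_
  ext ω
  simp only [mem_inter_iff, recentre_mem_sourceZero, recentre_mem_completedZero, mem_univ, and_true,
    mem_ofPred_eq]
  tauto

lemma measurableSet_completed (h : IsNumberedProcess P Φ X) (n : ℤ) :
    MeasurableSet {ω | Completed (fun j => X j ω) n} := by
  have := h.measurable_point
  exact measurableSet_le (by fun_prop) (by fun_prop)

lemma measurableSet_ne_zero_and_completed (h : IsNumberedProcess P Φ X) (n : ℤ) :
    MeasurableSet {ω | Φ ω ≠ 0 ∧ Completed (fun j => X j ω) n} :=
  (measurableSet_ne_zero h.measurable).inter (measurableSet_completed h n)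

lemma output_eq_thinned {Ω : Type*} {K : ℕ} (Φ : Ω → Measure (ℝ × Mark K))
    (X : ℤ → Ω → ℝ × Mark K) (ω : Ω) : output Φ X ω =
    thinned (fun n => Φ ω ≠ 0 ∧ Completed (fun j => X j ω) n) (fun n => complete (X n ω)) := by
  rw [output, thinned]
  congr 1
  funext n
  split_ifs <;> rfl

lemma measurable_output (h : IsNumberedProcess P Φ X) : Measurable (output Φ X) := by
  classical
  refine Measure.measurable_of_measurable_coe _ fun s hs => ?_
  simp_rw [output_eq_thinned, thinned_apply hs]
  exact Measurable.tsum fun n => Measurable.ite ((measurableSet_ne_zero_and_completed h n).inter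
    ((measurable_complete.comp (h.measurable_point n)) hs)) measurable_const measurable_const

lemma ae_thin_eq_thinned (h : IsNumberedProcess P Φ X) : ∀ᵐ ω ∂P, thin (Φ ω) =
    thinned (fun n => Φ ω ≠ 0 ∧ Completed (fun j => X j ω) n) (fun n => X n ω) := by
  filter_upwards [h.eq_sum, h.strictMono] with ω h1 h2
  by_cases h0 : Φ ω = 0
  · simp [thinned, h0, thin]
  · rw [thin_eq_thinned (h1 h0) (h2 h0)]
    simp only [ne_eq, h0, not_false_eq_true, true_and]

/-- This removes the numbering from the output, leaving a function of the configuration alone, to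
which stationarity of the input applies. -/
lemma ae_output_eq (h : IsNumberedProcess P Φ X) :
    output Φ X =ᵐ[P] fun ω => (thin (Φ ω)).map complete := by
  filter_upwards [ae_thin_eq_thinned h] with ω hω
  rw [hω, map_thinned measurable_complete, output_eq_thinned]

lemma isStationary_thin (h : IsNumberedProcess P Φ X) (hst : IsStationary P Φ) :
    IsStationary P (fun ω => thin (Φ ω)) :=
  hst.comp h.measurable.aemeasurable h.aemeasurable_thin thin_shift

lemma aemeasurable_thin_comp (h : IsNumberedProcess P Φ X) :
    AEMeasurable (fun ω => thin (Φ ω)) P :=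
  h.aemeasurable_thin.comp_aemeasurable h.measurable.aemeasurable

lemma isStationary_output (h : IsNumberedProcess P Φ X) (hst : IsStationary P Φ) :
    IsStationary P (output Φ X) := by
  have h1 : IsStationary P (fun ω => (thin (Φ ω)).map complete) :=
    (isStationary_thin h hst).comp (aemeasurable_thin_comp h)
      (Measure.measurable_map _ measurable_complete).aemeasurable map_complete_shift
  intro t
  have h2 := ae_output_eq h
  rw [Measure.map_congr h2, ← h1 t]
  exact Measure.map_congr (h2.mono fun ω hω => by simp only [hω])

lemma intensity_thin (h : IsNumberedProcess P Φ X) (hfin : intensity P Φ univ < ∞)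
    {B : Set (Mark K)} (hB : MeasurableSet B) : intensity P (fun ω => thin (Φ ω)) B =
      intensity P Φ B * palm P Φ X B (completedZero K) := by
  rw [h.intensity_mul_palm hB ((intensity_mono _ (subset_univ _)).trans_lt hfin)
    measurableSet_completedZero, intensity, lintegral_congr_ae ((ae_thin_eq_thinned h).mono
      fun ω hω => congrArg (fun ν : Measure (ℝ × Mark K) => ν (Ioc 0 1 ×ˢ B)) hω),
    lintegral_thinned (measurableSet_ne_zero_and_completed h) h.measurable_point
      (measurableSet_Ioc.prod hB)]
  refine tsum_congr fun n => congrArg P ?_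
  ext ω
  simp only [recentre_mem_completedZero, mem_ofPred_eq, mem_prod]
  tauto

/-- The completion rate of the packets with mark in `B`. -/
lemma intensity_output (h : IsNumberedProcess P Φ X) (hst : IsStationary P Φ)
    (hfin : intensity P Φ univ < ∞) {B : Set (Mark K)} (hB : MeasurableSet B) :
    intensity P (output Φ X) B = intensity P Φ B * palm P Φ X B (completedZero K) := by
  have hfin' : intensity P (fun ω => thin (Φ ω)) univ < ∞ :=
    (lintegral_mono fun ω => Measure.restrict_apply_le _ _).trans_lt hfin
  -- Completion displaces each kept packet by the delay carried in its own mark, so the output has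
  -- the intensity of the thinned input.
  rw [← intensity_thin h hfin hB, ← (isStationary_thin h hst).intensity_map_add
    (aemeasurable_thin_comp h) hfin' (f := fun m : Mark K => (m.2 : ℝ)) (by fun_prop) hB]
  exact lintegral_congr_ae ((ae_output_eq h).mono fun ω hω =>
    congrArg (fun ν : Measure (ℝ × Mark K) => ν (Ioc 0 1 ×ˢ B)) hω)

lemma measurable_completions (h : IsNumberedProcess P Φ X) (k : ℤ) :
    Measurable fun ω => completions (fun j => X j ω) k := by
  have ha : Measurable fun ω => firstPositive (fun j => X j ω) :=
    Measurable.ite (measurableSet_le (measurable_fst.comp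
      (measurable_complete.comp (h.measurable_point 0))) measurable_const)
      measurable_const measurable_const
  have hi := measurable_enumerate ha (measurableSet_completed h) k
  have hX : Measurable fun p : Ω × ℤ => X p.2 p.1 :=
    measurable_from_prod_countable_left fun n => h.measurable_point n
  exact measurable_complete.comp (hX.comp (measurable_id.prodMk hi))

lemma isNumberedProcess_output [IsFiniteMeasure P] (h : IsNumberedProcess P Φ X)
    (hst : IsStationary P Φ)
    (h_ties : ∀ᵐ ω ∂P, Φ ω ≠ 0 → ∀ n : ℤ,
      ¬ (((X n ω).2.2 : ℝ) = (X (n + 1) ω).1 - (X n ω).1 ∧ (X (n + 1) ω).2.2 = 0)) :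
    IsNumberedProcess P (output Φ X) (fun k ω => completions (fun j => X j ω) k) := by
  have hmeas := measurable_output h
  have hstout := isStationary_output h hst
  have hout : ∀ ω, output Φ X ω ≠ 0 → Φ ω ≠ 0 ∧ output Φ X ω =
      thinned (Completed fun j => X j ω) (fun n => complete (X n ω)) := by
    intro ω h0
    rw [output_eq_thinned] at h0 ⊢
    have hΦ : Φ ω ≠ 0 := fun h1 => h0 (by simp [thinned, h1])
    simp only [ne_eq, hΦ, not_false_eq_true, true_and]
  -- Recurrence is applied to the stationary output, not to the input: infinitely many generations
  -- on each side do not by themselves give infinitely many completions.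
  have hunb : ∀ᵐ ω ∂P, output Φ X ω ≠ 0 →
      (∀ m, ∃ n, m < n ∧ Completed (fun j => X j ω) n) ∧
        ∀ m, ∃ n, n < m ∧ Completed (fun j => X j ω) n := by
    filter_upwards [h.strictMono, h_ties, hstout.ae_Ioi_ne_zero hmeas.aemeasurable,
      hstout.ae_Iic_ne_zero hmeas.aemeasurable] with ω h1 h2 h3 h4 h0
    obtain ⟨hΦ, heq⟩ := hout ω h0
    have hne : ∃ n, Completed (fun j => X j ω) n := by
      rw [heq, ← Measure.measure_univ_ne_zero, thinned_apply_ne_zero .univ] at h0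
      exact h0.imp fun n hn => hn.1
    rw [heq] at h3 h4
    have hmono : ∀ n m, Completed (fun j => X j ω) n → n < m →
        (complete (X n ω)).1 < (complete (X m ω)).1 :=
      fun n m hn hnm => complete_lt_complete (h1 hΦ) (h2 hΦ) hn hnm
    exact ⟨exists_gt_of_thinned hmono h3 hne, exists_lt_of_thinned hmono h4 hne⟩
  refine ⟨hmeas, measurable_completions h, ?_, ?_, ?_, ?_⟩
  · filter_upwards [h.locallyFinite, h.eq_sum, h.strictMono] with ω h1 h2 h3 a b
    by_cases h0 : output Φ X ω = 0
    · simp [h0]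
    · obtain ⟨hΦ, heq⟩ := hout ω h0
      rw [heq]
      exact thinned_complete_Icc_lt_top (h2 hΦ) (h3 hΦ) h1 a b
  · filter_upwards [hunb] with ω h1 h0
    obtain ⟨hu, hl⟩ := h1 h0
    rw [(hout ω h0).2]
    exact thinned_eq_sum_dirac (strictMono_enumerate hu hl).injective (range_enumerate hu hl)
  · filter_upwards [hunb, h.strictMono, h_ties] with ω h1 h2 h3 h0 k l hkl
    obtain ⟨hu, hl⟩ := h1 h0
    have hΦ := (hout ω h0).1
    exact complete_lt_complete (h2 hΦ) (h3 hΦ) ((range_enumerate hu hl _).1 ⟨k, rfl⟩)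
      (strictMono_enumerate hu hl hkl)
  -- Only packet `0` can be generated at or before the origin and completed after it;
  -- `firstPositive` starts the positive numbers at `0` or `1` accordingly.
  · filter_upwards [hunb, h.strictMono, h.origin] with ω h1 h2 h3 h0
    obtain ⟨hu, hl⟩ := h1 h0
    have hΦ := (hout ω h0).1
    exact ⟨complete_nonpos_of_lt_firstPositive (h2 hΦ) (h3 hΦ).1
      ((range_enumerate hu hl _).1 ⟨0, rfl⟩) enumerate_zero_lt,
      complete_pos_of_firstPositive_le (h2 hΦ) (h3 hΦ).2 le_enumerate_one⟩

end PushoutOutput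

lemma IsNumberedProcess.isSimple (h : IsNumberedProcess P N X) : IsSimple P N := by
  classical
  filter_upwards [h.ae_eq_thinned, h.strictMono] with ω h1 h2 t
  by_cases h0 : N ω = 0
  · simp [h0]
  rw [h1, thinned_apply ((measurableSet_singleton t).prod .univ)]
  by_cases hex : ∃ n, (X n ω).1 = t
  · obtain ⟨n, rfl⟩ := hex
    rw [tsum_eq_single n]
    · split_ifs <;> simp
    · intro m hm
      rw [if_neg]
      rintro ⟨-, hmt, -⟩
      exact hm ((h2 h0).injective hmt)
  · push Not at hex
    simp [hex]

end

end

end PushoutServer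

/-! ### Assembly of the output properties and of the rate formulas. -/

theorem mainTheorem5 {Ω : Type*} [MeasurableSpace Ω] (P : Measure Ω) [IsProbabilityMeasure P]
    {K : ℕ} (Φ : Ω → Measure (ℝ × PushoutServer.Mark K))
    (X : ℤ → Ω → ℝ × PushoutServer.Mark K)
    (hΦ : PushoutServer.InputAssumption P Φ X)
    (h_ties : ∀ᵐ ω ∂P, Φ ω ≠ 0 → ∀ n : ℤ,
      ¬ (((X n ω).2.2 : ℝ) = (X (n + 1) ω).1 - (X n ω).1 ∧ (X (n + 1) ω).2.2 = 0)) :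
    ∃ Y : ℤ → Ω → ℝ × PushoutServer.Mark K,
      PushoutServer.OutputAssumption P (PushoutServer.output Φ X) Y ∧
      PushoutServer.intensity P (PushoutServer.output Φ X) univ =
        PushoutServer.intensity P Φ univ *
          PushoutServer.palm P Φ X univ (PushoutServer.completedZero K) ∧
      PushoutServer.intensity P (PushoutServer.output Φ X) univ =
        ∑ k : Fin K, PushoutServer.intensity P Φ (PushoutServer.ofSource k) *
          PushoutServer.palm P Φ X (PushoutServer.ofSource k) (PushoutServer.completedZero K) ∧
      ∀ k : Fin K,
        PushoutServer.palm P (PushoutServer.output Φ X) Y univ (PushoutServer.sourceZero k) =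
          ProbabilityTheory.cond (PushoutServer.palm P Φ X univ) (PushoutServer.completedZero K)
            (PushoutServer.sourceZero k) ∧
        PushoutServer.palm P (PushoutServer.output Φ X) Y univ (PushoutServer.sourceZero k) =
          PushoutServer.intensity P Φ (PushoutServer.ofSource k) *
              PushoutServer.palm P Φ X (PushoutServer.ofSource k) (PushoutServer.completedZero K) /
            ∑ j : Fin K, PushoutServer.intensity P Φ (PushoutServer.ofSource j) *
              PushoutServer.palm P Φ X (PushoutServer.ofSource j)
                (PushoutServer.completedZero K) := by

  have hN := hΦ.numbered
  have hst := hΦ.stationary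
  have hfin := hΦ.intensity_lt_top
  have hpos := hΦ.intensity_pos
  have hnum := PushoutServer.isNumberedProcess_output hN hst h_ties
  set Y : ℤ → Ω → ℝ × PushoutServer.Mark K :=
    fun k ω => PushoutServer.completions (fun j => X j ω) k
  have hint : ∀ {B : Set (PushoutServer.Mark K)}, MeasurableSet B →
      PushoutServer.intensity P (PushoutServer.output Φ X) B =
        PushoutServer.intensity P Φ B *
          PushoutServer.palm P Φ X B (PushoutServer.completedZero K) :=
    fun hB => PushoutServer.intensity_output hN hst hfin hB
  have hsum : PushoutServer.intensity P (PushoutServer.output Φ X) univ =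
      ∑ k : Fin K, PushoutServer.intensity P Φ (PushoutServer.ofSource k) *
        PushoutServer.palm P Φ X (PushoutServer.ofSource k) (PushoutServer.completedZero K) := by
    rw [← PushoutServer.sum_intensity_ofSource hnum.measurable.aemeasurable]
    exact Finset.sum_congr rfl fun k _ => hint (PushoutServer.measurableSet_ofSource k)
  have hfin' : PushoutServer.intensity P (PushoutServer.output Φ X) univ < ∞ := by
    rw [hint .univ]
    exact ENNReal.mul_lt_top hfin ((measure_mono (subset_univ _)).trans_lt
      ((hN.palm_univ .univ hpos.ne' hfin).trans_lt ENNReal.one_lt_top))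
  have hposk : ∀ k : Fin K,
      PushoutServer.intensity P (PushoutServer.output Φ X) (PushoutServer.ofSource k) ≠ 0 := by
    intro k
    rw [hint (PushoutServer.measurableSet_ofSource k), ← hN.intensity_ofSource hfin k]
    exact mul_ne_zero (mul_ne_zero hpos.ne' (hΦ.source_pos k).ne') (hΦ.completed_pos k).ne'
  have hpos' : 0 < PushoutServer.intensity P (PushoutServer.output Φ X) univ := by
    -- There is at least one source: with none, the input intensity would be an empty sum, hence
    -- zero.
    have hK : ∃ k : Fin K, True := by
      by_contra! hK
      have : IsEmpty (Fin K) := ⟨hK⟩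
      rw [← PushoutServer.sum_intensity_ofSource hN.measurable.aemeasurable] at hpos
      simp at hpos
    obtain ⟨k, -⟩ := hK
    exact (pos_iff_ne_zero.2 (hposk k)).trans_le (PushoutServer.intensity_mono _ (subset_univ _))
  have hpalm : ∀ k : Fin K, PushoutServer.palm P (PushoutServer.output Φ X) Y univ
      (PushoutServer.sourceZero k) =
        PushoutServer.intensity P (PushoutServer.output Φ X) (PushoutServer.ofSource k) /
          PushoutServer.intensity P (PushoutServer.output Φ X) univ := by
    intro k
    rw [ENNReal.eq_div_iff hpos'.ne' hfin'.ne, hnum.intensity_ofSource hfin' k]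
  refine ⟨Y, { numbered := hnum, simple := hnum.isSimple
               stationary := PushoutServer.isStationary_output hN hst
               intensity_pos := hpos', intensity_lt_top := hfin'
               source_pos := fun k => ?_, delay_finite := fun k => ?_ }, hint .univ, hsum,
    fun k => ⟨?_, ?_⟩⟩
  · rw [hpalm]
    exact ENNReal.div_pos (hposk k) hfin'.ne
  · simp only [ENNReal.coe_lt_top, Set.ofPred_true]
    exact hnum.palm_univ (PushoutServer.measurableSet_ofSource k) (hposk k)
      ((PushoutServer.intensity_mono _ (subset_univ _)).trans_lt hfin')
  -- Writing numerator and denominator as `λ` times Palm probabilities of the input, the factor `λ`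
  -- cancels and the conditional probability remains.
  · rw [hpalm, hint (PushoutServer.measurableSet_ofSource k), hint .univ,
      ← hN.intensity_completed_sourceZero hfin k,
      ENNReal.mul_div_mul_left _ _ hpos.ne' hfin.ne,
      ProbabilityTheory.cond_apply PushoutServer.measurableSet_completedZero, ENNReal.div_eq_inv_mul]
  · rw [hpalm, hsum, hint (PushoutServer.measurableSet_ofSource k)]
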